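/- There is an absolute constant $K$ such that for every $C_1\in\mathbb{N}$ there exist a measurable function $f:\mathbb{R}^2\to\{0,1\}$, constants $C_0,c>0$ and $d_0\in\mathbb{N}$ (depending only on $C_1$) such that the following holds for all real $C_2\ge C_0$ and all integers $d\ge d_0$. Consider the family of Boolean 2-index models \[ \mathcal F=\{\,f_{\mathbf U}(\mathbf x)=f(\mathbf U\mathbf x)\;:\;\mathbf U\in\mathbb{R}^{2\times d},\ \mathbf U\mathbf U^\top=\mathbf I_2\,\},\qquad \mathbf x\sim\mathcal N(\mathbf 0,\mathbf I_d). \] (i) No algorithm that is given only the exact moments of degree at most $C_1$, namely $\mathbf E[\mathbf x^{\alpha}f_{\mathbf U}(\mathbf x)]$ for all $\alpha\in\mathbb{N}^d$ with $|\alpha|\le C_1$, can output a member $f'$ of $\mathcal F$ with $\mathbf E[(f_{\mathbf U}(\mathbf x)-f'(\mathbf x))^2]\le 1/C_2$: for every (possibly randomized) algorithm there is a $\mathbf U$ with $\mathbf U\mathbf U^\top=\mathbf I_2$ for which it succeeds with probability at most $e^{-cd}$; in particular every deterministic algorithm fails on some $\mathbf U$. (ii) There is a deterministic adaptive statistical query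 algorithm that, for every $\varepsilon>0$ and every $\mathbf U$ with $\mathbf U\mathbf U^\top=\mathbf I_2$, makes at most $Kd^2$ queries to the oracle $\mathrm{VSTAT}(C_2d^2/\varepsilon^2)$ for the distribution $D$ of $(\mathbf x,f_{\mathbf U}(\mathbf x))$ and, whatever the valid answers are, outputs $\widehat{\mathbf U}\in\mathbb{R}^{2\times d}$ with $\|\widehat{\mathbf U}-\mathbf U\|_2\le\varepsilon$ (spectral norm). Here a query is a measurable $q:\mathbb{R}^d\times\{0,1\}\to[-1,1]$, and $\mathrm{VSTAT}(u)$ answers it with any value $v$ satisfying $|v-\mathbf E_D[q]|\le\max\bigl(1/u,\sqrt{\mathrm{Var}_D[q]/u}\bigr)$. -/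

import Mathlib

open MeasureTheory ProbabilityTheory Matrix
open scoped Matrix.Norms.L2Operator

noncomputable section

namespace MIM

/-- The standard Gaussian measure `N(0, I)` on `ℝ^d`. -/
def gauss (d : ℕ) : Measure (Fin d → ℝ) :=
  Measure.pi (fun _ => gaussianReal 0 1)

/-- The `2 × d` real matrices `U` with orthonormal rows, i.e. `U Uᵀ = I₂`. -/
abbrev Frame (d : ℕ) : Type :=
  {U : Matrix (Fin 2) (Fin d) ℝ // U * Uᵀ = 1}

/-- The σ-algebra on `Frame d` generated by the matrix entries (its Borel σ-algebra). -/
instance instMeasurableSpaceFrame (d : ℕ) : MeasurableSpace (Frame d) :=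
  MeasurableSpace.comap (fun (U : Frame d) (i : Fin 2) (j : Fin d) => U.1 i j) MeasurableSpace.pi

/-- The Boolean 2-index model `x ↦ f (U x)`.  For a fixed link function `f`, these functions with
`U` ranging over `Frame d` form the family attached to `f`. -/
def model {d : ℕ} (f : (Fin 2 → ℝ) → Bool) (U : Frame d) (x : Fin d → ℝ) : Bool :=
  f (U.1 *ᵥ x)

/-- The real value `0` or `1` of a Boolean label. -/
def label (b : Bool) : ℝ := if b then 1 else 0

/-- A table of real numbers indexed by the multi-indices `α ∈ ℕ^d` of total degree at most `m`. -/
abbrev MomentTable (d m : ℕ) : Type :=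
  {α : Fin d → ℕ // ∑ i, α i ≤ m} → ℝ

/-- The exact moments `E[x^α g(x)]`, `|α| ≤ m`, of a Boolean function `g` under `x ∼ N(0, I)`.
(As `g` takes the values `0` and `1` only, higher powers of `g` give nothing new.) -/
def moments {d : ℕ} (m : ℕ) (g : (Fin d → ℝ) → Bool) : MomentTable d m :=
  fun α => ∫ x, (∏ i, x i ^ α.1 i) * label (g x) ∂(gauss d)

/-- The squared `L²` distance `E[(g(x) - h(x))²]` of two Boolean functions under `x ∼ N(0, I)`. -/
def sqError {d : ℕ} (g h : (Fin d → ℝ) → Bool) : ℝ :=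
  ∫ x, (label (g x) - label (h x)) ^ 2 ∂(gauss d)

/-- The joint law on `ℝ^d × {0,1}` of `(x, g(x))` with `x ∼ N(0, I)`. -/
def labelledLaw {d : ℕ} (g : (Fin d → ℝ) → Bool) : Measure ((Fin d → ℝ) × Bool) :=
  (gauss d).map (fun x => (x, g x))

/-- A statistical query: a measurable function with values in `[-1, 1]`. -/
structure Query (X : Type*) [MeasurableSpace X] where
  toFun : X → ℝ
  measurable : Measurable toFun
  bounded : ∀ x, toFun x ∈ Set.Icc (-1 : ℝ) 1

/-- `v` is an admissible answer of the oracle `VSTAT(u)` for `D` to the query `q`: it is within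
`max (1/u) (√(Var_D[q]/u))` of `E_D[q]`. -/
def IsVSTATAnswer {X : Type*} [MeasurableSpace X] (D : Measure X) (u : ℝ) (q : Query X)
    (v : ℝ) : Prop :=
  |v - ∫ x, q.toFun x ∂D| ≤ max (1 / u) (Real.sqrt (variance q.toFun D / u))

/-- An adaptive statistical query algorithm making `n` queries: the `i`-th query is a function of
the answers to the earlier ones, and the output is a function of all the answers. -/
structure SQAlgorithm (X : Type*) [MeasurableSpace X] (β : Type*) (n : ℕ) where
  ask : (i : Fin n) → (Fin i → ℝ) → Query X
  output : (Fin n → ℝ) → β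

/-- `a` is a possible list of answers received by `A` when it interacts with `VSTAT(u)` for `D`. -/
def SQAlgorithm.IsTranscript {X β : Type*} [MeasurableSpace X] {n : ℕ} (A : SQAlgorithm X β n)
    (D : Measure X) (u : ℝ) (a : Fin n → ℝ) : Prop :=
  ∀ i : Fin n, IsVSTATAnswer D u (A.ask i (fun j => a ⟨j, j.2.trans i.2⟩)) (a i)

end MIM

end

/-!
Let `s` be a step function with values in `{-1, 0, 1}`, supported in `[1, ∞)` and orthogonal under
the standard Gaussian measure to the polynomials of degree at most `C₁ + 1`, and label `z ∈ ℝ²` by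
`1` when `s(z₀)` is nonzero and has the sign of `z₁`. Such an `s` is the signed indicator of short
intervals at `C₁ + 3` prescribed points: one length is a free small parameter, and the inverse
function theorem solves for the others because the derivative of the moments is a weighted
Vandermonde matrix.

The label is `(|s(z₀)| + s(z₀) sign(z₁)) / 2`. Against a monomial of degree at most `C₁`, the second
term integrates to zero if the first row of the frame is a coordinate axis, so all frames with this
first row share their moments. A weight `w` that correlates with `s` undoes the orthogonality, so
that hypotheses with this first row and distant second rows have distant labels. If the second row
ranges over a scaled cube, one output is therefore good for an exponentially small fraction of the
frames only, and some frame is as bad as the average.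

For the statistical queries, the correlations of the label with the coordinates of `x` give a
multiple of the first row, since `E[f(z) z₁] = 0` and `E[f(z) z₀] > 0`. The correlations of the
label multiplied by the weight `w` of the estimated first coordinate then give the second row, the
estimation error being controlled because `w` is Lipschitz.
-/

namespace MIM

section Gaussian

instance isOpenPosMeasure_gaussianReal : (gaussianReal 0 1).IsOpenPosMeasure :=
  (gaussianReal_absolutelyContinuous' 0 one_ne_zero).isOpenPosMeasure

theorem integrable_id_gaussianReal {μ : ℝ} {v : NNReal} :
    Integrable (fun s => s) (gaussianReal μ v) :=
  (memLp_id_gaussianReal 1).integrable le_rfl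

theorem integrable_pow_gaussianReal {μ : ℝ} {v : NNReal} (k : ℕ) :
    Integrable (fun s => s ^ k) (gaussianReal μ v) :=
  (integrable_norm_iff (by fun_prop)).1 (by
    simpa using MemLp.integrable_norm_pow' (memLp_id_gaussianReal (μ := μ) (v := v) k))

instance isProbabilityMeasure_gauss (d : ℕ) : IsProbabilityMeasure (gauss d) := by
  unfold gauss; infer_instance

variable {d n k : ℕ}

theorem integrable_monomial_gauss (α : Fin d → ℕ) :
    Integrable (fun x : Fin d → ℝ => ∏ i, x i ^ α i) (gauss d) :=
  Integrable.fintype_prod fun i => integrable_pow_gaussianReal (α i)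

theorem integral_gauss_one (g : ℝ → ℝ) :
    ∫ y, g (y 0) ∂(gauss 1) = ∫ s, g s ∂(gaussianReal 0 1) :=
  (measurePreserving_piUnique fun _ : Fin 1 => gaussianReal 0 1).integral_comp' g

theorem integral_gauss_succ (g : (Fin (n + 1) → ℝ) → ℝ) :
    ∫ x, g x ∂(gauss (n + 1)) =
      ∫ p, g (Fin.cons p.1 p.2) ∂((gaussianReal 0 1).prod (gauss n)) := by
  rw [gauss,
    ← (measurePreserving_piFinSuccAbove (fun _ => gaussianReal 0 1) 0).symm.integral_comp' g]
  simp only [MeasurableEquiv.piFinSuccAbove_symm_apply, Fin.insertNthEquiv_zero]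
  rfl

theorem measurePreserving_toLp_gauss (d : ℕ) :
    MeasurePreserving (WithLp.toLp 2) (gauss d) (stdGaussian (EuclideanSpace ℝ (Fin d))) :=
  ⟨by fun_prop, map_pi_eq_stdGaussian⟩

theorem stdGaussian_map_of_comp_adjoint {E F : Type*} [NormedAddCommGroup E]
    [InnerProductSpace ℝ E] [FiniteDimensional ℝ E] [MeasurableSpace E] [BorelSpace E]
    [NormedAddCommGroup F] [InnerProductSpace ℝ F] [FiniteDimensional ℝ F] [MeasurableSpace F]
    [BorelSpace F] {L : E →ₗ[ℝ] F} (hL : L ∘ₗ L.adjoint = .id) :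
    (stdGaussian E).map L = stdGaussian F := by
  have measurable_L : Measurable L := L.continuous_of_finiteDimensional.measurable
  have : IsProbabilityMeasure ((stdGaussian E).map L) :=
    Measure.isProbabilityMeasure_map measurable_L.aemeasurable
  have norm_adjoint (t : F) : ‖L.adjoint t‖ ^ 2 = ‖t‖ ^ 2 := by
    rw [← real_inner_self_eq_norm_sq, L.adjoint_inner_left, ← LinearMap.comp_apply, hL,
      LinearMap.id_apply, real_inner_self_eq_norm_sq]
  refine Measure.ext_of_charFun (funext fun t => ?_)
  calc charFun ((stdGaussian E).map L) t = charFun (stdGaussian E) (L.adjoint t) := by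
        simp only [charFun_apply]
        rw [integral_map measurable_L.aemeasurable (by fun_prop)]
        simp only [L.adjoint_inner_right]
    _ = charFun (stdGaussian F) t := by
        rw [charFun_stdGaussian, charFun_stdGaussian, ← Complex.ofReal_pow, norm_adjoint,
          Complex.ofReal_pow]

theorem measurePreserving_mulVec_gauss {M : Matrix (Fin n) (Fin k) ℝ} (hM : M * Mᵀ = 1) :
    MeasurePreserving (M *ᵥ ·) (gauss k) (gauss n) := by
  have comp_adjoint : M.toEuclideanLin ∘ₗ M.toEuclideanLin.adjoint = .id := by
    rw [← Matrix.toEuclideanLin_conjTranspose_eq_adjoint, Matrix.toEuclideanLin,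
      ← Matrix.toLpLin_mul, Matrix.conjTranspose_eq_transpose_of_trivial, hM, Matrix.toLpLin_one]
  have toLp_mulVec : WithLp.toLp 2 ∘ (M *ᵥ ·) = M.toEuclideanLin ∘ WithLp.toLp 2 := rfl
  have comp_eq : ((gauss k).map (M *ᵥ ·)).map (WithLp.toLp 2) = (gauss n).map (WithLp.toLp 2) := by
    rw [Measure.map_map (by fun_prop) (by fun_prop), toLp_mulVec,
      ← Measure.map_map M.toEuclideanLin.continuous_of_finiteDimensional.measurable
        (by fun_prop), (measurePreserving_toLp_gauss k).map_eq,
      (measurePreserving_toLp_gauss n).map_eq, stdGaussian_map_of_comp_adjoint comp_adjoint]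
  exact ⟨by fun_prop, (MeasurableEquiv.toLp 2 (Fin n → ℝ)).map_measurableEquiv_injective comp_eq⟩

theorem integral_gauss_mulVec {M : Matrix (Fin n) (Fin k) ℝ} (hM : M * Mᵀ = 1)
    {g : (Fin n → ℝ) → ℝ} (hg : AEStronglyMeasurable g (gauss n)) :
    ∫ x, g (M *ᵥ x) ∂(gauss k) = ∫ z, g z ∂(gauss n) := by
  have preserving := measurePreserving_mulVec_gauss hM
  rw [← preserving.map_eq] at hg ⊢
  exact (integral_map preserving.aemeasurable hg).symm

theorem memLp_two_dotProduct_gauss (a : Fin d → ℝ) : MemLp (a ⬝ᵥ ·) 2 (gauss d) := by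
  have memLp_toLp : MemLp (WithLp.toLp 2) 2 (gauss d) :=
    IsGaussian.memLp_two_id.comp_measurePreserving (measurePreserving_toLp_gauss d)
  simpa [PiLp.inner_apply, dotProduct, mul_comm] using
    memLp_toLp.const_inner (𝕜 := ℝ) (WithLp.toLp 2 a)

theorem integral_dotProduct_sq_gauss (a : Fin d → ℝ) :
    ∫ x, (a ⬝ᵥ x) ^ 2 ∂(gauss d) = a ⬝ᵥ a := by
  set L := innerSL ℝ (WithLp.toLp 2 a)
  have apply_toLp (x : Fin d → ℝ) : L (WithLp.toLp 2 x) = a ⬝ᵥ x := by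
    simp [L, PiLp.inner_apply, dotProduct, mul_comm]
  calc ∫ x, (a ⬝ᵥ x) ^ 2 ∂(gauss d) = ∫ y, L y ^ 2 ∂(stdGaussian (EuclideanSpace ℝ (Fin d))) := by
        rw [← (measurePreserving_toLp_gauss d).integral_comp
          (MeasurableEquiv.toLp 2 (Fin d → ℝ)).measurableEmbedding]
        simp only [apply_toLp]
    _ = Var[L; stdGaussian (EuclideanSpace ℝ (Fin d))] := (variance_of_integral_eq_zero
        L.continuous.aemeasurable (integral_strongDual_stdGaussian L)).symm
    _ = a ⬝ᵥ a := by
        rw [variance_dual_stdGaussian, innerSL_apply_norm, EuclideanSpace.real_norm_sq_eq]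
        simp [dotProduct, sq]

theorem memLp_two_eval_gauss (i : Fin d) : MemLp (fun x : Fin d → ℝ => x i) 2 (gauss d) := by
  simpa using memLp_two_dotProduct_gauss (Pi.single i (1 : ℝ))

theorem integral_eval_sq_gauss (i : Fin d) : ∫ x, x i ^ 2 ∂(gauss d) = 1 := by
  simpa using integral_dotProduct_sq_gauss (Pi.single i (1 : ℝ))

end Gaussian

section CauchySchwarz

theorem sq_integral_mul_le {α : Type*} [MeasurableSpace α] {μ : Measure α} {f g : α → ℝ}
    (hf : MemLp f 2 μ) (hg : MemLp g 2 μ) :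
    (∫ x, f x * g x ∂μ) ^ 2 ≤ (∫ x, f x ^ 2 ∂μ) * ∫ x, g x ^ 2 ∂μ := by
  have inner_toLp {u v : α → ℝ} (hu : MemLp u 2 μ) (hv : MemLp v 2 μ) :
      inner ℝ (hu.toLp u) (hv.toLp v) = ∫ x, u x * v x ∂μ := by
    rw [L2.inner_def]
    refine integral_congr_ae ?_
    filter_upwards [hu.coeFn_toLp, hv.coeFn_toLp] with x hux hvx
    simp [hux, hvx, mul_comm]
  simpa only [inner_toLp, sq] using real_inner_mul_inner_self_le (hf.toLp f) (hg.toLp g)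

theorem sq_integral_mul_dotProduct_gauss_le {d : ℕ} {f : (Fin d → ℝ) → ℝ}
    (hf : MemLp f 2 (gauss d)) (a : Fin d → ℝ) :
    (∫ x, f x * (a ⬝ᵥ x) ∂(gauss d)) ^ 2 ≤ (∫ x, f x ^ 2 ∂(gauss d)) * (a ⬝ᵥ a) := by
  rw [← integral_dotProduct_sq_gauss]
  exact sq_integral_mul_le hf (memLp_two_dotProduct_gauss a)

end CauchySchwarz

section Reflection

variable {n d : ℕ} {A : Matrix (Fin n) (Fin d) ℝ}

/-- The orthogonal reflection of `ℝ^d` that fixes the row space of a matrix `A` with orthonormal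
rows and negates its orthogonal complement. -/
def rowReflection (A : Matrix (Fin n) (Fin d) ℝ) : Matrix (Fin d) (Fin d) ℝ :=
  (2 : ℝ) • (Aᵀ * A) - 1

theorem mul_rowReflection (hA : A * Aᵀ = 1) : A * rowReflection A = A := by
  rw [rowReflection, Matrix.mul_sub, Matrix.mul_smul, ← Matrix.mul_assoc, hA, Matrix.one_mul,
    Matrix.mul_one, two_smul, add_sub_cancel_right]

theorem rowReflection_mul_transpose (hA : A * Aᵀ = 1) :
    rowReflection A * (rowReflection A)ᵀ = 1 := by
  have symmetric : (rowReflection A)ᵀ = rowReflection A := by simp [rowReflection]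
  rw [symmetric]
  nth_rewrite 1 [rowReflection]
  rw [Matrix.sub_mul, Matrix.smul_mul, Matrix.mul_assoc, mul_rowReflection hA, Matrix.one_mul,
    rowReflection, sub_sub_cancel]

theorem dotProduct_add_dotProduct_rowReflection_mulVec (a x : Fin d → ℝ) :
    a ⬝ᵥ x + a ⬝ᵥ (rowReflection A *ᵥ x) = 2 * ((A *ᵥ a) ⬝ᵥ (A *ᵥ x)) := by
  rw [rowReflection, Matrix.sub_mulVec, Matrix.smul_mulVec, Matrix.one_mulVec,
    ← Matrix.mulVec_mulVec, dotProduct_sub, add_sub_cancel, dotProduct_smul, smul_eq_mul,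
    Matrix.dotProduct_mulVec, Matrix.vecMul_transpose]

/- Averaging over the reflection, which fixes `A x`, replaces `x` by its projection to the row
space of `A`. -/
theorem integral_comp_mulVec_mul_dotProduct (hA : A * Aᵀ = 1) {g : (Fin n → ℝ) → ℝ}
    (hg : MemLp g 2 (gauss n)) (a : Fin d → ℝ) :
    ∫ x, g (A *ᵥ x) * (a ⬝ᵥ x) ∂(gauss d) = ∑ k, (A *ᵥ a) k * ∫ z, g z * z k ∂(gauss n) := by
  set S := rowReflection A
  have orthogonal : S * Sᵀ = 1 := rowReflection_mul_transpose hA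
  have memLp_comp : MemLp (fun x => g (A *ᵥ x)) 2 (gauss d) :=
    hg.comp_measurePreserving (measurePreserving_mulVec_gauss hA)
  have integrable : Integrable (fun x => g (A *ᵥ x) * (a ⬝ᵥ x)) (gauss d) :=
    memLp_comp.integrable_mul (memLp_two_dotProduct_gauss a)
  have integrable_reflected : Integrable (fun x => g (A *ᵥ x) * (a ⬝ᵥ (S *ᵥ x))) (gauss d) :=
    memLp_comp.integrable_mul
      ((memLp_two_dotProduct_gauss a).comp_measurePreserving
        (measurePreserving_mulVec_gauss orthogonal))
  have integrable_mul_eval (k : Fin n) : Integrable (fun z => g z * z k) (gauss n) :=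
    hg.integrable_mul (memLp_two_eval_gauss k)
  have reflected : ∫ x, g (A *ᵥ x) * (a ⬝ᵥ (S *ᵥ x)) ∂(gauss d) =
      ∫ x, g (A *ᵥ x) * (a ⬝ᵥ x) ∂(gauss d) := by
    rw [← integral_gauss_mulVec orthogonal integrable.1]
    simp only [S, Matrix.mulVec_mulVec, mul_rowReflection hA]
  have twice : 2 * ∫ x, g (A *ᵥ x) * (a ⬝ᵥ x) ∂(gauss d) =
      2 * ∑ k, (A *ᵥ a) k * ∫ z, g z * z k ∂(gauss n) := by
    calc 2 * ∫ x, g (A *ᵥ x) * (a ⬝ᵥ x) ∂(gauss d)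
      _ = ∫ x, g (A *ᵥ x) * (a ⬝ᵥ x + a ⬝ᵥ (S *ᵥ x)) ∂(gauss d) := by
          simp only [mul_add]
          rw [integral_add integrable integrable_reflected, reflected, two_mul]
      _ = 2 * ∫ x, ∑ k, (A *ᵥ a) k * (g (A *ᵥ x) * (A *ᵥ x) k) ∂(gauss d) := by
          rw [← integral_const_mul]
          simp only [S, dotProduct_add_dotProduct_rowReflection_mulVec,
            dotProduct.eq_1 (A *ᵥ a), Finset.mul_sum, mul_left_comm]
      _ = 2 * ∫ z, ∑ k, (A *ᵥ a) k * (g z * z k) ∂(gauss n) := by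
          rw [integral_gauss_mulVec hA (integrable_finsetSum _ fun k _ =>
            (integrable_mul_eval k).const_mul _).1]
      _ = 2 * ∑ k, (A *ᵥ a) k * ∫ z, g z * z k ∂(gauss n) := by
          rw [integral_finsetSum _ fun k _ => (integrable_mul_eval k).const_mul _]
          simp only [integral_const_mul]
  exact mul_left_cancel₀ two_ne_zero twice

end Reflection

section OrientedIntervals

/-- The signed indicator function of the oriented interval from `p` to `p + l`: it is `1` on
`(p, p + l]` if `0 ≤ l` and `-1` on `(p + l, p]` if `l ≤ 0`. -/
noncomputable def orientedIndicator (p l s : ℝ) : ℝ :=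
  (Set.Ioc p (p + l)).indicator 1 s - (Set.Ioc (p + l) p).indicator 1 s

theorem measurable_orientedIndicator (p l : ℝ) : Measurable (orientedIndicator p l) :=
  (measurable_one.indicator measurableSet_Ioc).sub (measurable_one.indicator measurableSet_Ioc)

theorem orientedIndicator_mem (p l s : ℝ) :
    orientedIndicator p l s = 0 ∨ orientedIndicator p l s = 1 ∨ orientedIndicator p l s = -1 := by
  unfold orientedIndicator
  by_cases right : s ∈ Set.Ioc p (p + l) <;> by_cases left : s ∈ Set.Ioc (p + l) p
  · exact absurd right.1 left.2.not_gt
  all_goals simp [right, left]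

theorem orientedIndicator_eq_one {p l s : ℝ} (hs : s ∈ Set.Ioc p (p + l)) :
    orientedIndicator p l s = 1 := by
  have not_left : s ∉ Set.Ioc (p + l) p := fun left => hs.1.not_ge left.2
  simp [orientedIndicator, hs, not_left]

theorem abs_sub_le_of_orientedIndicator_ne_zero {p l s : ℝ} (h : orientedIndicator p l s ≠ 0) :
    |s - p| ≤ |l| := by
  contrapose! h
  have not_right : s ∉ Set.Ioc p (p + l) := fun right => h.not_ge <| by
    rw [abs_of_pos (sub_pos.2 right.1)]
    linarith [right.2, le_abs_self l]
  have not_left : s ∉ Set.Ioc (p + l) p := fun left => h.not_ge <| by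
    rw [abs_of_nonpos (sub_nonpos.2 left.2)]
    linarith [left.1, neg_le_abs l]
  simp [orientedIndicator, not_right, not_left]

theorem mul_orientedIndicator (g : ℝ → ℝ) (p l s : ℝ) :
    g s * orientedIndicator p l s =
      (Set.Ioc p (p + l)).indicator g s - (Set.Ioc (p + l) p).indicator g s := by
  simp [orientedIndicator, mul_sub, Set.indicator_apply]

theorem integrable_mul_orientedIndicator {g : ℝ → ℝ} (hg : Continuous g) (p l : ℝ) :
    Integrable (fun s => g s * orientedIndicator p l s) := by
  simp only [mul_orientedIndicator]
  exact (hg.integrableOn_Ioc.integrable_indicator measurableSet_Ioc).sub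
    (hg.integrableOn_Ioc.integrable_indicator measurableSet_Ioc)

theorem integral_mul_orientedIndicator {g : ℝ → ℝ} (hg : Continuous g) (p l : ℝ) :
    ∫ s, g s * orientedIndicator p l s = ∫ s in p..p + l, g s := by
  simp only [mul_orientedIndicator]
  rw [integral_sub (hg.integrableOn_Ioc.integrable_indicator measurableSet_Ioc)
    (hg.integrableOn_Ioc.integrable_indicator measurableSet_Ioc),
    integral_indicator measurableSet_Ioc, integral_indicator measurableSet_Ioc, intervalIntegral]

variable {ι : Type*} [Fintype ι]

/-- The step function taking the value `±1` on the oriented intervals from `p j` to `p j + l j`,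
meant for families of disjoint intervals. -/
noncomputable def signPattern (p l : ι → ℝ) (s : ℝ) : ℝ := ∑ j, orientedIndicator (p j) (l j) s

theorem measurable_signPattern (p l : ι → ℝ) : Measurable (signPattern p l) :=
  Finset.measurable_sum _ fun _ _ => measurable_orientedIndicator _ _

theorem exists_orientedIndicator_ne_zero {p l : ι → ℝ} {s : ℝ} (h : signPattern p l s ≠ 0) :
    ∃ j, orientedIndicator (p j) (l j) s ≠ 0 :=
  let ⟨j, _, hj⟩ := Finset.exists_ne_zero_of_sum_ne_zero h
  ⟨j, hj⟩

theorem signPattern_eq_orientedIndicator {p l : ι → ℝ}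
    (separated : Pairwise fun i j => |l i| + |l j| < |p i - p j|)
    {s : ℝ} {j : ι} (hj : orientedIndicator (p j) (l j) s ≠ 0) :
    signPattern p l s = orientedIndicator (p j) (l j) s := by
  refine Finset.sum_eq_single j (fun i _ hij => ?_) (by simp)
  by_contra hi
  have close_i := abs_sub_le_of_orientedIndicator_ne_zero hi
  have close_j := abs_sub_le_of_orientedIndicator_ne_zero hj
  linarith [separated hij, abs_sub_le (p i) s (p j), abs_sub_comm (p i) s]

theorem signPattern_mem {p l : ι → ℝ}
    (separated : Pairwise fun i j => |l i| + |l j| < |p i - p j|) (s : ℝ) :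
    signPattern p l s = 0 ∨ signPattern p l s = 1 ∨ signPattern p l s = -1 := by
  by_cases h : signPattern p l s = 0
  · exact Or.inl h
  · obtain ⟨j, hj⟩ := exists_orientedIndicator_ne_zero h
    rw [signPattern_eq_orientedIndicator separated hj]
    exact orientedIndicator_mem _ _ _

theorem integral_mul_signPattern {g : ℝ → ℝ} (hg : Continuous g) (p l : ι → ℝ) :
    ∫ s, g s * signPattern p l s = ∑ j, ∫ s in p j..p j + l j, g s := by
  simp only [signPattern, Finset.mul_sum]
  rw [integral_finsetSum _ fun j _ => integrable_mul_orientedIndicator hg (p j) (l j)]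
  exact Finset.sum_congr rfl fun j _ => integral_mul_orientedIndicator hg (p j) (l j)

end OrientedIntervals

section Cancellation

open scoped Topology

variable {ι κ : Type*} [Fintype ι]

theorem hasStrictFDerivAt_sum_intervalIntegral {g : κ → ℝ → ℝ} (hg : ∀ a, Continuous (g a))
    (p : ι → ℝ) :
    HasStrictFDerivAt (fun (l : ι → ℝ) a => ∑ j, ∫ s in p j..p j + l j, g a s)
      (LinearMap.toContinuousLinearMap (Matrix.of fun a j => g a (p j)).mulVecLin) 0 := by
  rw [hasStrictFDerivAt_pi']
  intro a
  have term_deriv (j : ι) : HasStrictFDerivAt (fun l : ι → ℝ => ∫ s in p j..p j + l j, g a s)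
      (g a (p j) • ContinuousLinearMap.proj (R := ℝ) (φ := fun _ : ι => ℝ) j) 0 := by
    have primitive_deriv : HasStrictDerivAt (fun u => ∫ s in p j..u, g a s) (g a (p j))
        (p j + (0 : ι → ℝ) j) := by
      simpa using (hg a).integral_hasStrictDerivAt (p j) (p j)
    exact primitive_deriv.comp_hasStrictFDerivAt (0 : ι → ℝ)
      ((ContinuousLinearMap.proj (R := ℝ) (φ := fun _ : ι => ℝ) j).hasStrictFDerivAt.const_add
        (p j))
  convert HasStrictFDerivAt.fun_sum (u := Finset.univ) fun j _ => term_deriv j using 1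
  ext l
  simp [Matrix.mulVec, dotProduct]

theorem image_sum_intervalIntegral_mem_nhds [DecidableEq ι] {g : ι → ℝ → ℝ}
    (hg : ∀ a, Continuous (g a)) {p : ι → ℝ} (hdet : (Matrix.of fun a j => g a (p j)).det ≠ 0)
    {s : Set (ι → ℝ)} (hs : s ∈ 𝓝 0) :
    (fun l a => ∑ j, ∫ s in p j..p j + l j, g a s) '' s ∈ 𝓝 0 := by
  have surjective : (LinearMap.toContinuousLinearMap
      (Matrix.of fun a j => g a (p j)).mulVecLin).range = ⊤ :=
    LinearMap.range_eq_top.2 (Matrix.mulVec_surjective_iff_isUnit.2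
      ((Matrix.isUnit_iff_isUnit_det _).2 hdet.isUnit))
  have map_nhds := (hasStrictFDerivAt_sum_intervalIntegral hg p).map_nhds_eq_of_surj surjective
  have at_zero : (fun a => ∑ j, ∫ s in p j..p j + (0 : ι → ℝ) j, g a s) = 0 := by
    ext a; simp
  rw [at_zero] at map_nhds
  exact map_nhds ▸ Filter.image_mem_map hs

theorem exists_lengths_sum_intervalIntegral_eq_zero {n : ℕ} {g : Fin n → ℝ → ℝ}
    (hg : ∀ a, Continuous (g a)) {p : Fin (n + 1) → ℝ}
    (hdet : (Matrix.of fun a (j : Fin n) => g a (p j.succ)).det ≠ 0) {δ : ℝ} (hδ : 0 < δ) :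
    ∃ l : Fin (n + 1) → ℝ, 0 < l 0 ∧ (∀ j, |l j| < δ) ∧
      ∀ a, ∑ j, ∫ s in p j..p j + l j, g a s = 0 := by
  have continuous_first : Continuous fun (t : ℝ) a => -∫ s in p 0..p 0 + t, g a s :=
    continuous_pi fun a => ((intervalIntegral.continuous_primitive
      (fun _ _ => (hg a).intervalIntegrable _ _) (p 0)).comp (by fun_prop)).neg
  have first_tendsto : Filter.Tendsto (fun (t : ℝ) a => -∫ s in p 0..p 0 + t, g a s)
      (𝓝 0) (𝓝 0) := by
    convert continuous_first.tendsto 0 using 2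
    ext a; simp
  have eventually_solvable := first_tendsto.eventually_mem
    (image_sum_intervalIntegral_mem_nhds hg hdet (Metric.ball_mem_nhds 0 hδ))
  obtain ⟨t, ⟨l, hl, hlt⟩, ht⟩ := ((eventually_solvable.filter_mono nhdsWithin_le_nhds).and
    (Ioo_mem_nhdsGT hδ)).exists
  refine ⟨Fin.cons t l, ht.1, fun j => ?_, fun a => ?_⟩
  · cases j using Fin.cases with
    | zero => simpa [abs_of_pos ht.1] using ht.2
    | succ j => simpa using (norm_le_pi_norm l j).trans_lt (mem_ball_zero_iff.1 hl)
  · simp only [Fin.sum_univ_succ, Fin.cons_zero, Fin.cons_succ]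
    rw [show ∑ j : Fin n, _ = _ from congrFun hlt a, add_neg_cancel]

theorem det_weighted_vandermonde_ne_zero {n : ℕ} {φ : ℝ → ℝ} (hφ : ∀ s, φ s ≠ 0) {p : Fin n → ℝ}
    (hp : Function.Injective p) :
    (Matrix.of fun a j : Fin n => φ (p j) * p j ^ (a : ℕ)).det ≠ 0 := by
  have factorization : (Matrix.of fun a j : Fin n => φ (p j) * p j ^ (a : ℕ)) =
      (Matrix.vandermonde p)ᵀ * Matrix.diagonal (φ ∘ p) := by
    ext a j
    simp [Matrix.vandermonde_apply, mul_comm]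
  rw [factorization, Matrix.det_mul, Matrix.det_transpose, Matrix.det_diagonal]
  exact mul_ne_zero (Matrix.det_vandermonde_ne_zero_iff.2 hp)
    (Finset.prod_ne_zero_iff.2 fun j _ => hφ _)

end Cancellation

section SignProfile

/-- A step function `sign` with values in `{-1, 0, 1}`, supported in `[1, ∞)` and orthogonal to the
polynomials of degree at most `m` under the standard Gaussian measure, together with a bounded
Lipschitz function `weight` that correlates with it. -/
structure SignProfile (m : ℕ) where
  sign : ℝ → ℝ
  weight : ℝ → ℝ
  measurable_sign : Measurable sign
  sign_mem : ∀ s, sign s = 0 ∨ sign s = 1 ∨ sign s = -1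
  one_le_of_sign_ne_zero : ∀ s, sign s ≠ 0 → 1 ≤ s
  integral_pow_mul_sign : ∀ a ≤ m, ∫ s, s ^ a * sign s ∂(gaussianReal 0 1) = 0
  abs_weight_le_one : ∀ s, |weight s| ≤ 1
  lipschitz_weight : LipschitzWith 1 weight
  integral_weight_mul_sign_pos : 0 < ∫ s, weight s * sign s ∂(gaussianReal 0 1)

theorem infDist_compl_Ioo_le {q t : ℝ} (ht : 0 ≤ t) (s : ℝ) :
    Metric.infDist s (Set.Ioo q (q + t))ᶜ ≤ t := by
  by_cases hs : s ∈ Set.Ioo q (q + t)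
  · refine (Metric.infDist_le_dist_of_mem (y := q) (by simp)).trans ?_
    rw [Real.dist_eq, abs_of_pos (sub_pos.2 hs.1)]
    linarith [hs.2]
  · rwa [Metric.infDist_zero_of_mem hs]

theorem integral_infDist_compl_Ioo_mul_pos {q t : ℝ} (ht : 0 < t) {g : ℝ → ℝ}
    (hg : ∀ s ∈ Set.Ioo q (q + t), g s = 1) :
    0 < ∫ s, Metric.infDist s (Set.Ioo q (q + t))ᶜ * g s ∂(gaussianReal 0 1) := by
  have mul_eq (s : ℝ) : Metric.infDist s (Set.Ioo q (q + t))ᶜ * g s =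
      Metric.infDist s (Set.Ioo q (q + t))ᶜ := by
    by_cases hs : s ∈ Set.Ioo q (q + t)
    · rw [hg s hs, mul_one]
    · rw [Metric.infDist_zero_of_mem hs, zero_mul]
  have pos_at_midpoint : 0 < Metric.infDist (q + t / 2) (Set.Ioo q (q + t))ᶜ := by
    rw [← isOpen_Ioo.isClosed_compl.notMem_iff_infDist_pos ⟨q, by simp⟩, Set.notMem_compl_iff]
    constructor <;> linarith
  have integrable : Integrable (fun s => Metric.infDist s (Set.Ioo q (q + t))ᶜ)
      (gaussianReal 0 1) :=
    .of_bound (Metric.continuous_infDist_pt _).aestronglyMeasurable t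
      (.of_forall fun s => by
        rw [Real.norm_of_nonneg Metric.infDist_nonneg]
        exact infDist_compl_Ioo_le ht.le s)
  simp only [mul_eq]
  exact integral_pos_of_integrable_nonneg_nonzero (Metric.continuous_infDist_pt _)
    integrable (fun _ => Metric.infDist_nonneg) pos_at_midpoint.ne'

theorem exists_lengths_integral_pow_mul_signPattern_eq_zero (m : ℕ) {p : Fin (m + 2) → ℝ}
    (hp : Function.Injective p) {δ : ℝ} (hδ : 0 < δ) :
    ∃ l : Fin (m + 2) → ℝ, 0 < l 0 ∧ (∀ j, |l j| < δ) ∧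
      ∀ a ≤ m, ∫ s, s ^ a * signPattern p l s ∂(gaussianReal 0 1) = 0 := by
  set φ := gaussianPDFReal 0 1 with hφ
  have continuous_density : Continuous φ := by rw [hφ, gaussianPDFReal_def]; fun_prop
  obtain ⟨l, l_zero_pos, l_lt, sum_eq_zero⟩ := exists_lengths_sum_intervalIntegral_eq_zero
    (g := fun (a : Fin (m + 1)) s => φ s * s ^ (a : ℕ)) (fun a => by fun_prop)
    (det_weighted_vandermonde_ne_zero (fun s => (gaussianPDFReal_pos 0 1 s one_ne_zero).ne')
      (hp.comp (Fin.succ_injective _))) hδ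
  refine ⟨l, l_zero_pos, l_lt, fun a ha => ?_⟩
  rw [integral_gaussianReal_eq_integral_smul one_ne_zero]
  simp only [smul_eq_mul, ← mul_assoc]
  rw [integral_mul_signPattern (g := fun s => φ s * s ^ a) (by fun_prop)]
  exact sum_eq_zero ⟨a, by omega⟩

theorem nonempty_signProfile (m : ℕ) : Nonempty (SignProfile m) := by
  set p : Fin (m + 2) → ℝ := fun j => 2 * ((j : ℝ) + 1) with hp
  have two_le_dist {i j : Fin (m + 2)} (hij : i ≠ j) : 2 ≤ |p i - p j| := by
    have one_le : (1 : ℝ) ≤ |(i : ℝ) - j| := by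
      exact_mod_cast Int.one_le_abs (sub_ne_zero.2 (by exact_mod_cast Fin.val_ne_of_ne hij :
        ((i : ℕ) : ℤ) ≠ (j : ℕ)))
    rw [hp, ← mul_sub, add_sub_add_right_eq_sub, abs_mul, abs_two]
    linarith
  have injective : Function.Injective p := fun i j hij => by
    by_contra hne
    have two_le_zero := two_le_dist hne
    norm_num [hij] at two_le_zero
  obtain ⟨l, l_zero_pos, l_lt_one, orthogonal⟩ :=
    exists_lengths_integral_pow_mul_signPattern_eq_zero m injective one_pos
  have separated : Pairwise fun i j => |l i| + |l j| < |p i - p j| := fun i j hij => by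
    linarith [two_le_dist hij, l_lt_one i, l_lt_one j]
  have sign_eq_one (s : ℝ) (hs : s ∈ Set.Ioo (p 0) (p 0 + l 0)) : signPattern p l s = 1 := by
    have indicator_eq_one := orientedIndicator_eq_one (Set.Ioo_subset_Ioc_self hs)
    rw [signPattern_eq_orientedIndicator separated (indicator_eq_one.trans_ne one_ne_zero),
      indicator_eq_one]
  refine ⟨{ sign := signPattern p l
            weight := fun s => Metric.infDist s (Set.Ioo (p 0) (p 0 + l 0))ᶜ
            measurable_sign := measurable_signPattern p l
            sign_mem := signPattern_mem separated
            one_le_of_sign_ne_zero := fun s hs => ?_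
            integral_pow_mul_sign := orthogonal
            abs_weight_le_one := fun s => ?_
            lipschitz_weight := Metric.lipschitz_infDist_pt _
            integral_weight_mul_sign_pos :=
              integral_infDist_compl_Ioo_mul_pos l_zero_pos sign_eq_one }⟩
  · obtain ⟨j, hj⟩ := exists_orientedIndicator_ne_zero hs
    have close := (abs_sub_le_of_orientedIndicator_ne_zero hj).trans_lt (l_lt_one j)
    have two_le : 2 ≤ p j := by simp [hp]
    linarith [(abs_lt.1 close).1]
  · rw [abs_of_nonneg Metric.infDist_nonneg]
    exact (infDist_compl_Ioo_le l_zero_pos.le s).trans ((le_abs_self _).trans (l_lt_one 0).le)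

end SignProfile

section Link

/-- The sign of a real number, with the value `-1` at `0`, so that it never vanishes. -/
noncomputable def leftSign (s : ℝ) : ℝ := if 0 < s then 1 else -1

theorem leftSign_mem (s : ℝ) : leftSign s = 1 ∨ leftSign s = -1 :=
  ite_eq_or_eq _ _ _

theorem leftSign_mul_self (s : ℝ) : leftSign s * s = |s| := by
  rcases lt_or_ge 0 s with hs | hs
  · simp [leftSign, hs, abs_of_pos hs]
  · simp [leftSign, hs.not_gt, abs_of_nonpos hs]

theorem abs_leftSign (s : ℝ) : |leftSign s| = 1 := by
  rcases leftSign_mem s with h | h <;> simp [h]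

theorem measurable_leftSign : Measurable leftSign :=
  Measurable.ite measurableSet_Ioi measurable_const measurable_const

theorem measurable_label : Measurable label :=
  measurable_of_countable label

theorem abs_label_le_one (b : Bool) : |label b| ≤ 1 := by
  cases b <;> simp [label]

theorem abs_label_sub_label_le_one (b c : Bool) : |label b - label c| ≤ 1 := by
  cases b <;> cases c <;> simp [label]

namespace SignProfile

variable {m : ℕ} (P : SignProfile m)

theorem abs_sign_le_one (s : ℝ) : |P.sign s| ≤ 1 := by
  rcases P.sign_mem s with h | h | h <;> simp [h]

theorem measurable_weight : Measurable P.weight :=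
  P.lipschitz_weight.continuous.measurable

/-- The link function of the hard family: the label `1` is given to the points `z` for which
`sign (z 0)` is nonzero and has the sign of `z 1`. -/
noncomputable def link (z : Fin 2 → ℝ) : Bool := decide (0 < P.sign (z 0) * leftSign (z 1))

theorem measurable_link : Measurable P.link := by
  refine measurable_to_bool ?_
  have preimage_true : P.link ⁻¹' {true} = {z | 0 < P.sign (z 0) * leftSign (z 1)} := by
    ext z; simp [link]
  rw [preimage_true]
  exact measurableSet_lt measurable_const ((P.measurable_sign.comp (measurable_pi_apply 0)).mul
    (measurable_leftSign.comp (measurable_pi_apply 1)))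

theorem label_link (z : Fin 2 → ℝ) :
    label (P.link z) = (|P.sign (z 0)| + P.sign (z 0) * leftSign (z 1)) / 2 := by
  rcases P.sign_mem (z 0) with h | h | h <;> rcases leftSign_mem (z 1) with h' | h' <;>
    simp [link, label, h, h', (zero_le_one (α := ℝ)).not_gt]

theorem integral_mul_label_link_cons {n : ℕ} {p : ℝ → ℝ} (hp : Integrable p (gaussianReal 0 1))
    {q : (Fin n → ℝ) → ℝ} (hq : Integrable q (gauss n)) {t : (Fin n → ℝ) → ℝ} (ht : Measurable t) :
    ∫ x, p (x 0) * q (Fin.tail x) * label (P.link ![x 0, t (Fin.tail x)]) ∂(gauss (n + 1)) =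
      ((∫ s, p s * |P.sign s| ∂(gaussianReal 0 1)) * (∫ y, q y ∂(gauss n)) +
        (∫ s, p s * P.sign s ∂(gaussianReal 0 1)) *
          ∫ y, q y * leftSign (t y) ∂(gauss n)) / 2 := by
  have integrable_abs : Integrable (fun s => p s * |P.sign s|) (gaussianReal 0 1) :=
    hp.mul_bdd P.measurable_sign.abs.aestronglyMeasurable
      (.of_forall fun s => by simpa using P.abs_sign_le_one s)
  have integrable_sign : Integrable (fun s => p s * P.sign s) (gaussianReal 0 1) :=
    hp.mul_bdd P.measurable_sign.aestronglyMeasurable (.of_forall P.abs_sign_le_one)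
  have integrable_leftSign : Integrable (fun y => q y * leftSign (t y)) (gauss n) :=
    hq.mul_bdd (measurable_leftSign.comp ht).aestronglyMeasurable
      (.of_forall fun y => (abs_leftSign (t y)).le)
  rw [integral_gauss_succ, ← integral_prod_mul, ← integral_prod_mul,
    ← integral_add (integrable_abs.mul_prod hq) (integrable_sign.mul_prod integrable_leftSign),
    ← integral_div]
  congr! 2
  simp only [label_link, Fin.cons_zero, Fin.tail_cons, Matrix.cons_val_zero, Matrix.cons_val_one]
  ring

theorem integral_mul_label_link {p q : ℝ → ℝ} (hp : Integrable p (gaussianReal 0 1))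
    (hq : Integrable q (gaussianReal 0 1)) :
    ∫ z, p (z 0) * q (z 1) * label (P.link z) ∂(gauss 2) =
      ((∫ s, p s * |P.sign s| ∂(gaussianReal 0 1)) * (∫ s, q s ∂(gaussianReal 0 1)) +
        (∫ s, p s * P.sign s ∂(gaussianReal 0 1)) *
          ∫ s, q s * leftSign s ∂(gaussianReal 0 1)) / 2 := by
  have eta (z : Fin 2 → ℝ) : ![z 0, Fin.tail z 0] = z := List.ofFn_inj.1 rfl
  have hq' : Integrable (fun y => q (y 0)) (gauss 1) :=
    (measurePreserving_eval (fun _ : Fin 1 => gaussianReal 0 1) 0).integrable_comp_of_integrable hq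
  have factored := P.integral_mul_label_link_cons hp hq' (measurable_pi_apply 0)
  simp only [eta, integral_gauss_one, integral_gauss_one fun s => q s * leftSign s] at factored
  exact factored

/-- The correlation `E[f(z) z₀]` of the label with the first coordinate. -/
noncomputable def firstCorr : ℝ := ∫ z, label (P.link z) * z 0 ∂(gauss 2)

/-- The correlation `E[f(z) w(z₀) z₀]` of the weighted label with the first coordinate. -/
noncomputable def crossCorr : ℝ := ∫ z, label (P.link z) * P.weight (z 0) * z 0 ∂(gauss 2)

/-- The correlation `E[f(z) w(z₀) z₁]` of the weighted label with the second coordinate. -/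
noncomputable def secondCorr : ℝ := ∫ z, label (P.link z) * P.weight (z 0) * z 1 ∂(gauss 2)

theorem integrable_weight : Integrable P.weight (gaussianReal 0 1) :=
  .of_bound P.measurable_weight.aestronglyMeasurable 1 (.of_forall P.abs_weight_le_one)

theorem integral_label_link_mul_eval_one : ∫ z, label (P.link z) * z 1 ∂(gauss 2) = 0 := by
  have sign_centered : ∫ s, P.sign s ∂(gaussianReal 0 1) = 0 := by
    simpa using P.integral_pow_mul_sign 0 m.zero_le
  have factored := P.integral_mul_label_link (integrable_const 1) integrable_id_gaussianReal
  simpa [sign_centered, integral_id_gaussianReal, mul_comm] using factored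

theorem secondCorr_pos : 0 < P.secondCorr := by
  have abs_moment_pos : 0 < ∫ s, |s| ∂(gaussianReal 0 1) :=
    integral_pos_of_integrable_nonneg_nonzero (x := 1) continuous_abs
      integrable_id_gaussianReal.abs (fun s => abs_nonneg s) (by simp)
  have factored := P.integral_mul_label_link P.integrable_weight integrable_id_gaussianReal
  simp only [integral_id_gaussianReal, mul_zero, zero_add, mul_comm _ (leftSign _),
    leftSign_mul_self, mul_comm _ (label _), ← mul_assoc] at factored
  rw [secondCorr, factored]
  exact div_pos (mul_pos P.integral_weight_mul_sign_pos abs_moment_pos) two_pos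

theorem weight_mul_sign_le (s : ℝ) : P.weight s * P.sign s ≤ s * |P.sign s| := by
  by_cases h : P.sign s = 0
  · simp [h]
  · calc P.weight s * P.sign s ≤ |P.weight s| * |P.sign s| := by
          rw [← abs_mul]; exact le_abs_self _
      _ ≤ s * |P.sign s| := by
          gcongr
          exact (P.abs_weight_le_one s).trans (P.one_le_of_sign_ne_zero s h)

theorem firstCorr_pos (hm : 1 ≤ m) : 0 < P.firstCorr := by
  have sign_orthogonal : ∫ s, s * P.sign s ∂(gaussianReal 0 1) = 0 := by
    simpa using P.integral_pow_mul_sign 1 hm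
  have pos : 0 < ∫ s, s * |P.sign s| ∂(gaussianReal 0 1) :=
    P.integral_weight_mul_sign_pos.trans_le <| integral_mono
      (P.integrable_weight.mul_bdd P.measurable_sign.aestronglyMeasurable
        (.of_forall P.abs_sign_le_one))
      (integrable_id_gaussianReal.mul_bdd P.measurable_sign.abs.aestronglyMeasurable
        (.of_forall fun s => by simpa using P.abs_sign_le_one s)) P.weight_mul_sign_le
  have factored := P.integral_mul_label_link integrable_id_gaussianReal (integrable_const 1)
  simp only [sign_orthogonal, mul_one, zero_mul, add_zero, integral_const, probReal_univ,
    one_smul, mul_comm _ (label _)] at factored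
  rw [firstCorr, factored]
  exact half_pos pos

end SignProfile

end Link

section Correlations

namespace SignProfile

variable {m d : ℕ} (P : SignProfile m)

theorem measurable_model (U : Frame d) : Measurable (model P.link U) :=
  P.measurable_link.comp (by fun_prop)

theorem memLp_label_comp_mul_weight_comp {α : Type*} [MeasurableSpace α] {μ : Measure α}
    [IsFiniteMeasure μ] {g : α → Bool} (hg : Measurable g) {t : α → ℝ} (ht : Measurable t) :
    MemLp (fun x => label (g x) * P.weight (t x)) 2 μ :=
  .of_bound ((measurable_label.comp hg).mul (P.measurable_weight.comp ht)).aestronglyMeasurable 1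
    (.of_forall fun _ => (abs_mul _ _).trans_le
      (mul_le_one₀ (abs_label_le_one _) (abs_nonneg _) (P.abs_weight_le_one _)))

theorem integral_label_model_mul_dotProduct (U : Frame d) (a : Fin d → ℝ) :
    ∫ x, label (model P.link U x) * (a ⬝ᵥ x) ∂(gauss d) = P.firstCorr * (U.1 *ᵥ a) 0 := by
  have memLp_label : MemLp (fun z => label (P.link z)) 2 (gauss 2) :=
    .of_bound (measurable_label.comp P.measurable_link).aestronglyMeasurable 1
      (.of_forall fun _ => abs_label_le_one _)
  have expansion := integral_comp_mulVec_mul_dotProduct U.2 memLp_label a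
  rwa [Fin.sum_univ_two, P.integral_label_link_mul_eval_one, mul_zero, add_zero,
    mul_comm] at expansion

theorem integral_label_model_mul_weight_mul_dotProduct (U : Frame d) (a : Fin d → ℝ) :
    ∫ x, label (model P.link U x) * P.weight (U.1 0 ⬝ᵥ x) * (a ⬝ᵥ x) ∂(gauss d) =
      P.crossCorr * (U.1 *ᵥ a) 0 + P.secondCorr * (U.1 *ᵥ a) 1 := by
  have expansion := integral_comp_mulVec_mul_dotProduct U.2
    (P.memLp_label_comp_mul_weight_comp P.measurable_link (measurable_pi_apply 0)) a
  rwa [Fin.sum_univ_two, mul_comm, mul_comm ((U.1 *ᵥ a) 1)] at expansion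

theorem integral_sub_label_mul_weight_mul_dotProduct {U V : Frame d} (h : U.1 0 = V.1 0)
    (a : Fin d → ℝ) :
    ∫ x, (label (model P.link U x) - label (model P.link V x)) * P.weight (U.1 0 ⬝ᵥ x) *
      (a ⬝ᵥ x) ∂(gauss d) = P.secondCorr * (a ⬝ᵥ (U.1 1 - V.1 1)) := by
  have integrable (W : Frame d) : Integrable (fun x => label (model P.link W x) *
      P.weight (U.1 0 ⬝ᵥ x) * (a ⬝ᵥ x)) (gauss d) :=
    (P.memLp_label_comp_mul_weight_comp (P.measurable_model W) (by fun_prop)).integrable_mul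
      (memLp_two_dotProduct_gauss a)
  have correlation_V := P.integral_label_model_mul_weight_mul_dotProduct V a
  rw [← h] at correlation_V
  simp only [sub_mul]
  rw [integral_sub (integrable U) (integrable V), correlation_V,
    P.integral_label_model_mul_weight_mul_dotProduct U a, mulVec, mulVec, mulVec, mulVec, h,
    add_sub_add_left_eq_sub, ← mul_sub, ← sub_dotProduct, dotProduct_comm]

theorem secondCorr_sq_mul_le_sqError {U V : Frame d} (h : U.1 0 = V.1 0) :
    P.secondCorr ^ 2 * ((U.1 1 - V.1 1) ⬝ᵥ (U.1 1 - V.1 1)) ≤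
      sqError (model P.link U) (model P.link V) := by
  set a := U.1 1 - V.1 1
  set f := fun x => label (model P.link U x) - label (model P.link V x)
  set w := fun x => P.weight (U.1 0 ⬝ᵥ x)
  have measurable_f : Measurable f := (measurable_label.comp (P.measurable_model U)).sub
    (measurable_label.comp (P.measurable_model V))
  have measurable_w : Measurable w := P.measurable_weight.comp (by fun_prop)
  have abs_f_mul_w_le (x : Fin d → ℝ) : |f x * w x| ≤ |f x| := by
    rw [abs_mul]
    exact mul_le_of_le_one_right (abs_nonneg _) (P.abs_weight_le_one _)
  have memLp_f : MemLp f 2 (gauss d) := .of_bound measurable_f.aestronglyMeasurable 1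
    (.of_forall fun _ => abs_label_sub_label_le_one _ _)
  have memLp_f_mul_w : MemLp (fun x => f x * w x) 2 (gauss d) :=
    memLp_f.mono (measurable_f.mul measurable_w).aestronglyMeasurable (.of_forall abs_f_mul_w_le)
  have weighted_le : ∫ x, (f x * w x) ^ 2 ∂(gauss d) ≤
      sqError (model P.link U) (model P.link V) :=
    integral_mono memLp_f_mul_w.integrable_sq memLp_f.integrable_sq fun x =>
      sq_le_sq.2 (abs_f_mul_w_le x)
  have cauchy_schwarz : (P.secondCorr * (a ⬝ᵥ a)) ^ 2 ≤
      (∫ x, (f x * w x) ^ 2 ∂(gauss d)) * (a ⬝ᵥ a) := by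
    rw [← P.integral_sub_label_mul_weight_mul_dotProduct h]
    exact sq_integral_mul_dotProduct_gauss_le memLp_f_mul_w a
  have a_nonneg : 0 ≤ a ⬝ᵥ a := dotProduct_self_star_nonneg a
  rcases a_nonneg.eq_or_lt with a_eq_zero | a_pos
  · rw [← a_eq_zero, mul_zero]
    exact integral_nonneg fun x => sq_nonneg _
  · refine le_of_mul_le_mul_right ?_ a_pos
    calc P.secondCorr ^ 2 * (a ⬝ᵥ a) * (a ⬝ᵥ a) = (P.secondCorr * (a ⬝ᵥ a)) ^ 2 := by ring
      _ ≤ _ := cauchy_schwarz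
      _ ≤ _ := by gcongr

end SignProfile

end Correlations

section TruncatedMean

theorem abs_truncation_sub_self_le {α : Type*} (f : α → ℝ) {T : ℝ} (hT : 0 < T) (x : α) :
    |truncation f T x - f x| ≤ f x ^ 2 / T := by
  by_cases hx : |f x| < T
  · rw [truncation_eq_self hx, sub_self, abs_zero]
    positivity
  · have truncation_le : |truncation f T x - f x| ≤ |f x| := by
      simp only [truncation, Function.comp_apply, Set.indicator_apply]
      split_ifs <;> simp
    rw [le_div_iff₀ hT, ← sq_abs, sq]
    gcongr
    exact not_lt.1 hx

variable {X : Type*} [MeasurableSpace X] {D : Measure X} {Y : X → ℝ} {T v : ℝ}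

theorem abs_integral_truncation_sub_le [IsFiniteMeasure D] (hY : MemLp Y 2 D) (hT : 0 < T) :
    |∫ x, truncation Y T x ∂D - ∫ x, Y x ∂D| ≤ (∫ x, Y x ^ 2 ∂D) / T := by
  rw [← integral_sub hY.1.integrable_truncation (hY.integrable one_le_two), ← integral_div]
  exact abs_integral_le_integral_abs.trans <| integral_mono
    ((hY.1.integrable_truncation.sub (hY.integrable one_le_two)).abs)
    (hY.integrable_sq.div_const T) (abs_truncation_sub_self_le Y hT)

theorem variance_truncation_le [IsProbabilityMeasure D] (hY : MemLp Y 2 D) (T : ℝ) :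
    variance (truncation Y T) D ≤ ∫ x, Y x ^ 2 ∂D :=
  (variance_le_expectation_sq hY.1.truncation).trans <|
    integral_mono hY.1.memLp_truncation.integrable_sq hY.integrable_sq fun x =>
      sq_le_sq.2 (abs_truncation_le_abs_self Y T x)

/-- The statistical query that estimates the mean of `Y`, truncated at height `T` and rescaled. -/
noncomputable def truncatedMeanQuery (T : ℝ) (hY : Measurable Y) : Query X where
  toFun x := truncation Y T x / T
  measurable := ((measurable_id.indicator measurableSet_Ioc).comp hY).div_const T
  bounded x := by
    rw [Set.mem_Icc, ← abs_le, abs_div]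
    exact div_le_one_of_le₀ (abs_truncation_le_bound Y T x) (abs_nonneg T)

/- The standard deviation of the query is at most `1 / T`, so the oracle error is at most `1 / T²`;
the factor `T` turns it into `1 / T`, which is also the truncation bias. -/
theorem abs_mul_answer_sub_integral_le [IsProbabilityMeasure D] (hY : Measurable Y)
    (memLp_Y : MemLp Y 2 D) (sq_le_one : ∫ x, Y x ^ 2 ∂D ≤ 1) (hT : 0 < T)
    (hv : IsVSTATAnswer D (T ^ 2) (truncatedMeanQuery T hY) v) :
    |T * v - ∫ x, Y x ∂D| ≤ 2 / T := by
  have variance_le : variance (truncatedMeanQuery T hY).toFun D ≤ 1 / T ^ 2 := by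
    simp only [truncatedMeanQuery, div_eq_inv_mul _ T, variance_const_mul]
    rw [inv_pow, ← div_eq_inv_mul]
    gcongr
    exact (variance_truncation_le memLp_Y T).trans sq_le_one
  have answer_close : |T * v - ∫ x, truncation Y T x ∂D| ≤ 1 / T := by
    have oracle_error : |v - (∫ x, truncation Y T x ∂D) / T| ≤ 1 / T ^ 2 := by
      rw [← integral_div]
      refine hv.trans (max_le le_rfl (Real.sqrt_le_iff.2 ⟨by positivity, ?_⟩))
      rw [sq (1 / T ^ 2), div_eq_mul_one_div (variance _ _)]
      gcongr
    calc |T * v - ∫ x, truncation Y T x ∂D| = T * |v - (∫ x, truncation Y T x ∂D) / T| := by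
          rw [← abs_of_pos hT, ← abs_mul, abs_of_pos hT, mul_sub, mul_div_cancel₀ _ hT.ne']
      _ ≤ T * (1 / T ^ 2) := by gcongr
      _ = 1 / T := by field_simp
  calc |T * v - ∫ x, Y x ∂D|
      ≤ |T * v - ∫ x, truncation Y T x ∂D| + |∫ x, truncation Y T x ∂D - ∫ x, Y x ∂D| :=
        abs_sub_le _ _ _
    _ ≤ 1 / T + 1 / T := by
        gcongr
        exact (abs_integral_truncation_sub_le memLp_Y hT).trans (by gcongr)
    _ = 2 / T := by ring

end TruncatedMean

section CorrelationQuery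

variable {d : ℕ} {g : (Fin d → ℝ) → ℝ} {h : (Fin d → ℝ) → Bool} {T v : ℝ}

theorem measurePreserving_labelledLaw (hh : Measurable h) :
    MeasurePreserving (fun x => (x, h x)) (gauss d) (labelledLaw h) :=
  ⟨measurable_id.prodMk hh, rfl⟩

theorem measurable_label_mul_mul_eval (hg : Measurable g) (i : Fin d) :
    Measurable fun p : (Fin d → ℝ) × Bool => label p.2 * g p.1 * p.1 i :=
  ((measurable_label.comp measurable_snd).mul (hg.comp measurable_fst)).mul
    ((measurable_pi_apply i).comp measurable_fst)

/-- The truncated query for the correlation `E[y g(x) xᵢ]` of the weighted label with the `i`-th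
coordinate. -/
noncomputable def corrQuery (T : ℝ) (hg : Measurable g) (i : Fin d) : Query ((Fin d → ℝ) × Bool) :=
  truncatedMeanQuery T (measurable_label_mul_mul_eval hg i)

theorem abs_mul_answer_sub_correlation_le (hT : 0 < T) (hg : Measurable g)
    (abs_g_le_one : ∀ x, |g x| ≤ 1) (hh : Measurable h) (i : Fin d)
    (hv : IsVSTATAnswer (labelledLaw h) (T ^ 2) (corrQuery T hg i) v) :
    |T * v - ∫ x, label (h x) * g x * x i ∂(gauss d)| ≤ 2 / T := by
  set Y := fun p : (Fin d → ℝ) × Bool => label p.2 * g p.1 * p.1 i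
  have measurable_Y : Measurable Y := measurable_label_mul_mul_eval hg i
  have preserving := measurePreserving_labelledLaw hh
  have : IsProbabilityMeasure (labelledLaw h) :=
    Measure.isProbabilityMeasure_map preserving.aemeasurable
  have integral_law {f : (Fin d → ℝ) × Bool → ℝ} (hf : Measurable f) :
      ∫ p, f p ∂(labelledLaw h) = ∫ x, f (x, h x) ∂(gauss d) :=
    integral_map preserving.aemeasurable hf.aestronglyMeasurable
  have abs_Y_le (x : Fin d → ℝ) : |Y (x, h x)| ≤ |x i| := by
    rw [abs_mul, abs_mul]
    exact mul_le_of_le_one_left (abs_nonneg _)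
      (mul_le_one₀ (abs_label_le_one _) (abs_nonneg _) (abs_g_le_one _))
  have memLp_comp : MemLp (fun x => Y (x, h x)) 2 (gauss d) :=
    (memLp_two_eval_gauss i).mono (measurable_Y.comp preserving.measurable).aestronglyMeasurable
      (.of_forall abs_Y_le)
  have memLp_Y : MemLp Y 2 (labelledLaw h) :=
    (memLp_map_measure_iff measurable_Y.aestronglyMeasurable preserving.aemeasurable).2 memLp_comp
  have sq_le_one : ∫ p, Y p ^ 2 ∂(labelledLaw h) ≤ 1 := by
    rw [integral_law (measurable_Y.pow_const 2), ← integral_eval_sq_gauss i]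
    exact integral_mono memLp_comp.integrable_sq (memLp_two_eval_gauss i).integrable_sq
      fun x => sq_le_sq.2 (abs_Y_le x)
  have close := abs_mul_answer_sub_integral_le measurable_Y memLp_Y sq_le_one hT hv
  rwa [integral_law measurable_Y] at close

end CorrelationQuery

section Algorithm

theorem norm_le_of_sum_sq_le {ι κ : Type*} [Fintype ι] [Fintype κ] [DecidableEq κ]
    {M : Matrix ι κ ℝ} {ε : ℝ} (hε : 0 ≤ ε) (h : ∑ i, ∑ j, M i j ^ 2 ≤ ε ^ 2) : ‖M‖ ≤ ε := by
  rw [l2_opNorm_def]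
  refine ContinuousLinearMap.opNorm_le_bound _ hε fun x =>
    (pow_le_pow_iff_left₀ (norm_nonneg _) (by positivity) two_ne_zero).1 ?_
  rw [mul_pow, EuclideanSpace.real_norm_sq_eq, EuclideanSpace.real_norm_sq_eq]
  calc _ ≤ ∑ i, (∑ j, M i j ^ 2) * ∑ j, x j ^ 2 :=
        Finset.sum_le_sum fun i _ => Finset.sum_mul_sq_le_sq_mul_sq Finset.univ (M i) x
    _ = (∑ i, ∑ j, M i j ^ 2) * ∑ j, x j ^ 2 := (Finset.sum_mul ..).symm
    _ ≤ ε ^ 2 * ∑ j, x j ^ 2 := by gcongr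

namespace SignProfile

variable {m d : ℕ} (P : SignProfile m) {T : ℝ} {U : Frame d} {a : Fin (2 * d) → ℝ}

theorem measurable_weight_dotProduct (u : Fin d → ℝ) : Measurable fun x => P.weight (u ⬝ᵥ x) :=
  P.measurable_weight.comp (by fun_prop)

/-- The estimate of the first row of the hidden frame from answers to the queries for the
correlations of the label with the coordinates. -/
noncomputable def firstRow (T : ℝ) (b : Fin d → ℝ) : Fin d → ℝ :=
  fun j => T * b j / P.firstCorr

/-- The estimate of the second row of the hidden frame from an estimate `u` of the first row and
answers to the queries for the correlations of the weighted label with the coordinates. -/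
noncomputable def secondRow (T : ℝ) (u b : Fin d → ℝ) : Fin d → ℝ :=
  fun j => (T * b j - P.crossCorr * u j) / P.secondCorr

/-- The adaptive algorithm that recovers the hidden frame: the first `d` queries estimate the first
row, the other `d` queries use this estimate as the argument of the weight. All queries are
truncated at height `T`. -/
noncomputable def sqAlgorithm (d : ℕ) (T : ℝ) :
    SQAlgorithm ((Fin d → ℝ) × Bool) (Matrix (Fin 2) (Fin d) ℝ) (2 * d) where
  ask i prev :=
    if h : (i : ℕ) < d then corrQuery T (measurable_const (a := (1 : ℝ))) ⟨i, h⟩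
    else corrQuery T (P.measurable_weight_dotProduct (P.firstRow T fun j => prev ⟨j, by omega⟩))
      ⟨i - d, by omega⟩
  output a := Matrix.of ![P.firstRow T fun j => a ⟨j, by omega⟩,
    P.secondRow T (P.firstRow T fun j => a ⟨j, by omega⟩) fun j => a ⟨d + j, by omega⟩]

theorem abs_firstRow_sub_le (hm : 1 ≤ m) (hT : 0 < T)
    (ha : (P.sqAlgorithm d T).IsTranscript (labelledLaw (model P.link U)) (T ^ 2) a) (j : Fin d) :
    |P.firstRow T (fun j => a ⟨j, by omega⟩) j - U.1 0 j| ≤ 2 / P.firstCorr / T := by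
  have firstCorr_pos := P.firstCorr_pos hm
  have answer := ha ⟨j, by omega⟩
  simp only [sqAlgorithm, Fin.is_lt, dif_pos] at answer
  have close := abs_mul_answer_sub_correlation_le hT _ (by simp) (P.measurable_model U) _ answer
  have correlation := P.integral_label_model_mul_dotProduct U (Pi.single j 1)
  simp only [mul_one, Fin.eta, single_one_dotProduct, mulVec_single_one, col_apply]
    at close correlation
  rw [correlation] at close
  calc |P.firstRow T (fun j => a ⟨j, by omega⟩) j - U.1 0 j|
      = |T * a ⟨j, by omega⟩ - P.firstCorr * U.1 0 j| / P.firstCorr := by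
        rw [firstRow, ← abs_of_pos firstCorr_pos, ← abs_div, abs_of_pos firstCorr_pos, sub_div,
          mul_div_cancel_left₀ _ firstCorr_pos.ne']
    _ ≤ 2 / T / P.firstCorr := by gcongr
    _ = 2 / P.firstCorr / T := div_right_comm _ _ _

theorem abs_mul_weighted_answer_sub_le (hT : 0 < T)
    (ha : (P.sqAlgorithm d T).IsTranscript (labelledLaw (model P.link U)) (T ^ 2) a) (j : Fin d) :
    |T * a ⟨d + j, by omega⟩ - ∫ x, label (model P.link U x) *
      P.weight (P.firstRow T (fun j => a ⟨j, by omega⟩) ⬝ᵥ x) * x j ∂(gauss d)| ≤ 2 / T := by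
  have answer := ha ⟨d + j, by omega⟩
  simp only [sqAlgorithm, not_lt.2 (Nat.le_add_right d j), dif_neg, not_false_eq_true,
    Nat.add_sub_cancel_left, Fin.eta] at answer
  exact abs_mul_answer_sub_correlation_le hT _ (fun _ => P.abs_weight_le_one _)
    (P.measurable_model U) _ answer

theorem sq_integral_label_mul_weight_sub_le {h : (Fin d → ℝ) → Bool} (hh : Measurable h)
    (u v : Fin d → ℝ) (i : Fin d) :
    (∫ x, label (h x) * P.weight (u ⬝ᵥ x) * x i ∂(gauss d) -
      ∫ x, label (h x) * P.weight (v ⬝ᵥ x) * x i ∂(gauss d)) ^ 2 ≤ (u - v) ⬝ᵥ (u - v) := by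
  have memLp (c : Fin d → ℝ) : MemLp (fun x => label (h x) * P.weight (c ⬝ᵥ x)) 2 (gauss d) :=
    P.memLp_label_comp_mul_weight_comp hh (by fun_prop)
  have integrable (c : Fin d → ℝ) :
      Integrable (fun x => label (h x) * P.weight (c ⬝ᵥ x) * x i) (gauss d) :=
    (memLp c).integrable_mul (memLp_two_eval_gauss i)
  have memLp_sub := (memLp u).sub (memLp v)
  have abs_sub_le (x : Fin d → ℝ) : |label (h x) * P.weight (u ⬝ᵥ x) -
      label (h x) * P.weight (v ⬝ᵥ x)| ≤ |(u - v) ⬝ᵥ x| := by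
    rw [← mul_sub, abs_mul, sub_dotProduct]
    refine (mul_le_of_le_one_left (abs_nonneg _) (abs_label_le_one _)).trans ?_
    simpa [Real.dist_eq] using P.lipschitz_weight.dist_le_mul (u ⬝ᵥ x) (v ⬝ᵥ x)
  rw [← integral_sub (integrable u) (integrable v)]
  simp only [← sub_mul]
  calc _ ≤ _ := sq_integral_mul_le memLp_sub (memLp_two_eval_gauss i)
    _ = ∫ x, (label (h x) * P.weight (u ⬝ᵥ x) - label (h x) * P.weight (v ⬝ᵥ x)) ^ 2
        ∂(gauss d) := by rw [integral_eval_sq_gauss, mul_one]; rfl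
    _ ≤ ∫ x, ((u - v) ⬝ᵥ x) ^ 2 ∂(gauss d) :=
        integral_mono memLp_sub.integrable_sq (memLp_two_dotProduct_gauss _).integrable_sq
          fun x => sq_le_sq.2 (abs_sub_le x)
    _ = (u - v) ⬝ᵥ (u - v) := integral_dotProduct_sq_gauss _

/-- The factor by which the algorithm amplifies the errors of the answers. -/
noncomputable def amplification : ℝ :=
  2 / P.firstCorr + (2 + 2 / P.firstCorr + |P.crossCorr| * (2 / P.firstCorr)) / P.secondCorr

theorem amplification_pos (hm : 1 ≤ m) : 0 < P.amplification := by
  have firstCorr_pos := P.firstCorr_pos hm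
  have secondCorr_pos := P.secondCorr_pos
  unfold amplification
  positivity

theorem abs_weightedCorrelation_firstRow_sub_le (hm : 1 ≤ m) (hT : 0 < T)
    (ha : (P.sqAlgorithm d T).IsTranscript (labelledLaw (model P.link U)) (T ^ 2) a) (j : Fin d) :
    |∫ x, label (model P.link U x) *
        P.weight (P.firstRow T (fun j => a ⟨j, by omega⟩) ⬝ᵥ x) * x j ∂(gauss d) -
      (P.crossCorr * U.1 0 j + P.secondCorr * U.1 1 j)| ≤ 2 / P.firstCorr * (√d / T) := by
  have firstCorr_pos := P.firstCorr_pos hm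
  set u := P.firstRow T fun j : Fin d => a ⟨j, by omega⟩
  have correlation := P.integral_label_model_mul_weight_mul_dotProduct U (Pi.single j 1)
  simp only [single_one_dotProduct, mulVec_single_one, col_apply] at correlation
  rw [← correlation]
  refine abs_le_of_sq_le_sq ?_ (by positivity)
  calc _ ≤ (u - U.1 0) ⬝ᵥ (u - U.1 0) :=
        P.sq_integral_label_mul_weight_sub_le (P.measurable_model U) u (U.1 0) j
    _ = ∑ j, |u j - U.1 0 j| ^ 2 := Finset.sum_congr rfl fun j _ => by
        rw [sq_abs, Pi.sub_apply, sq]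
    _ ≤ ∑ _j : Fin d, (2 / P.firstCorr / T) ^ 2 := by
        gcongr with j
        exact P.abs_firstRow_sub_le hm hT ha j
    _ = (2 / P.firstCorr * (√d / T)) ^ 2 := by
        rw [Finset.sum_const, Finset.card_univ, Fintype.card_fin, nsmul_eq_mul, mul_pow,
          div_pow √d, Real.sq_sqrt (Nat.cast_nonneg d)]
        ring

theorem abs_secondRow_sub_le (hm : 1 ≤ m) (hT : 0 < T)
    (ha : (P.sqAlgorithm d T).IsTranscript (labelledLaw (model P.link U)) (T ^ 2) a) (j : Fin d) :
    |P.secondRow T (P.firstRow T fun j => a ⟨j, by omega⟩) (fun j => a ⟨d + j, by omega⟩) j -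
      U.1 1 j| ≤ (2 + 2 / P.firstCorr + |P.crossCorr| * (2 / P.firstCorr)) / P.secondCorr *
        (√d / T) := by
  have firstCorr_pos := P.firstCorr_pos hm
  have secondCorr_pos := P.secondCorr_pos
  have one_le_sqrt : 1 ≤ √(d : ℝ) := Real.one_le_sqrt.2 (by exact_mod_cast j.pos)
  have firstRow_error := P.abs_firstRow_sub_le hm hT ha j
  have answer_error := P.abs_mul_weighted_answer_sub_le hT ha j
  have weight_error := P.abs_weightedCorrelation_firstRow_sub_le hm hT ha j
  set u := P.firstRow T fun j : Fin d => a ⟨j, by omega⟩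
  set I := ∫ x, label (model P.link U x) * P.weight (u ⬝ᵥ x) * x j ∂(gauss d)
  set b := a ⟨d + j, by omega⟩
  calc |P.secondRow T u (fun j => a ⟨d + j, by omega⟩) j - U.1 1 j|
      = |T * b - I + (I - (P.crossCorr * U.1 0 j + P.secondCorr * U.1 1 j)) -
          P.crossCorr * (u j - U.1 0 j)| / P.secondCorr := by
        rw [← abs_of_pos secondCorr_pos, ← abs_div, abs_of_pos secondCorr_pos, secondRow]
        congr 1
        field_simp
        ring
    _ ≤ (2 / T + 2 / P.firstCorr * (√d / T) + |P.crossCorr| * (2 / P.firstCorr / T)) /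
          P.secondCorr := by
        refine div_le_div_of_nonneg_right ((abs_sub _ _).trans (add_le_add
          ((abs_add_le _ _).trans (add_le_add answer_error weight_error)) ?_)) secondCorr_pos.le
        rw [abs_mul]
        gcongr
    _ ≤ (2 * (√d / T) + 2 / P.firstCorr * (√d / T) +
          |P.crossCorr| * (2 / P.firstCorr * (√d / T))) / P.secondCorr := by
        rw [div_eq_mul_one_div 2 T, div_eq_mul_one_div (2 / P.firstCorr) T]
        gcongr
    _ = _ := by ring

theorem abs_output_sub_le (hm : 1 ≤ m) (hT : 0 < T)
    (ha : (P.sqAlgorithm d T).IsTranscript (labelledLaw (model P.link U)) (T ^ 2) a)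
    (k : Fin 2) (j : Fin d) :
    |(P.sqAlgorithm d T).output a k j - U.1 k j| ≤ P.amplification * (√d / T) := by
  have firstCorr_pos := P.firstCorr_pos hm
  have secondCorr_pos := P.secondCorr_pos
  have one_le_sqrt : 1 ≤ √(d : ℝ) := Real.one_le_sqrt.2 (by exact_mod_cast j.pos)
  rw [amplification, add_mul]
  fin_cases k
  · refine le_add_of_le_of_nonneg ((P.abs_firstRow_sub_le hm hT ha j).trans ?_) (by positivity)
    rw [div_eq_mul_one_div _ T]
    gcongr
  · exact le_add_of_nonneg_of_le (by positivity) (P.abs_secondRow_sub_le hm hT ha j)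

theorem norm_output_sub_le (hm : 1 ≤ m) (hd : 1 ≤ d) {C ε : ℝ}
    (hC : 2 * P.amplification ^ 2 ≤ C) (hε : 0 < ε)
    (ha : (P.sqAlgorithm d (√C * d / ε)).IsTranscript (labelledLaw (model P.link U))
      (C * d ^ 2 / ε ^ 2) a) :
    ‖(P.sqAlgorithm d (√C * d / ε)).output a - U.1‖ ≤ ε := by
  have amplification_pos := P.amplification_pos hm
  have C_pos : 0 < C := lt_of_lt_of_le (by positivity) hC
  have d_pos : (0 : ℝ) < d := by exact_mod_cast hd
  set T := √C * d / ε with T_def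
  have T_pos : 0 < T := by positivity
  have sq_T : C * d ^ 2 / ε ^ 2 = T ^ 2 := by rw [T_def, div_pow, mul_pow, Real.sq_sqrt C_pos.le]
  rw [sq_T] at ha
  refine norm_le_of_sum_sq_le hε.le ?_
  calc ∑ k, ∑ j, ((P.sqAlgorithm d T).output a - U.1) k j ^ 2
      = ∑ k, ∑ j, |(P.sqAlgorithm d T).output a k j - U.1 k j| ^ 2 := by
        simp only [sq_abs, Matrix.sub_apply]
    _ ≤ ∑ _k : Fin 2, ∑ _j : Fin d, (P.amplification * (√d / T)) ^ 2 := by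
        gcongr with k _ j
        exact P.abs_output_sub_le hm T_pos ha k j
    _ = 2 * P.amplification ^ 2 / C * ε ^ 2 := by
        rw [Finset.sum_const, Finset.sum_const, mul_pow, div_pow, ← sq_T, Real.sq_sqrt d_pos.le]
        simp only [Finset.card_univ, Fintype.card_fin, nsmul_eq_mul, Nat.cast_ofNat]
        field_simp
    _ ≤ ε ^ 2 := mul_le_of_le_one_left (sq_nonneg _) ((div_le_one C_pos).2 hC)

end SignProfile

end Algorithm

section LowerBound

/-- The frame of `ℝ^(n+1)` whose first row is the first basis vector and whose second row is the
unit vector `v` of the orthogonal complement `ℝ^n` of the first axis. -/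
def axisFrame {n : ℕ} (v : Fin n → ℝ) (hv : v ⬝ᵥ v = 1) : Frame (n + 1) :=
  ⟨of ![Fin.cons 1 0, Fin.cons 0 v], by
    ext i j
    rw [dotProduct] at hv
    fin_cases i <;> fin_cases j <;> simp [mul_apply, Fin.sum_univ_succ, hv]⟩

theorem axisFrame_mulVec {n : ℕ} {v : Fin n → ℝ} (hv : v ⬝ᵥ v = 1) (x : Fin (n + 1) → ℝ) :
    (axisFrame v hv).1 *ᵥ x = ![x 0, v ⬝ᵥ Fin.tail x] := by
  ext i
  fin_cases i <;> simp [axisFrame, mulVec, dotProduct, Fin.sum_univ_succ, Fin.tail]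

theorem moments_model_axisFrame {m n k : ℕ} (P : SignProfile m) (hk : k ≤ m) {v w : Fin n → ℝ}
    (hv : v ⬝ᵥ v = 1) (hw : w ⬝ᵥ w = 1) :
    moments k (model P.link (axisFrame v hv)) = moments k (model P.link (axisFrame w hw)) := by
  have moments_eq {u : Fin n → ℝ} (hu : u ⬝ᵥ u = 1)
      (α : {α : Fin (n + 1) → ℕ // ∑ i, α i ≤ k}) :
      moments k (model P.link (axisFrame u hu)) α =
        (∫ s, s ^ α.1 0 * |P.sign s| ∂(gaussianReal 0 1)) *
          (∫ y, ∏ i, y i ^ α.1 i.succ ∂(gauss n)) / 2 := by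
    have degree_le : α.1 0 ≤ m :=
      ((Finset.single_le_sum (fun _ _ => Nat.zero_le _) (Finset.mem_univ 0)).trans α.2).trans hk
    have fubini := P.integral_mul_label_link_cons (integrable_pow_gaussianReal (α.1 0))
      (integrable_monomial_gauss fun i : Fin n => α.1 i.succ)
      (t := fun y => u ⬝ᵥ y) (by fun_prop)
    rw [P.integral_pow_mul_sign _ degree_le, zero_mul, add_zero] at fubini
    simpa only [moments, model, axisFrame_mulVec, Fin.prod_univ_succ, Fin.tail] using fubini
  exact funext fun α => (moments_eq hv α).trans (moments_eq hw α).symm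

theorem measurable_frame_mulVec (d : ℕ) :
    Measurable fun p : Frame d × (Fin d → ℝ) => p.1.1 *ᵥ p.2 := by
  have measurable_entry (i : Fin 2) (j : Fin d) : Measurable fun V : Frame d => V.1 i j :=
    (measurable_pi_apply j).comp ((measurable_pi_apply i).comp (comap_measurable _))
  refine measurable_pi_lambda _ fun i => ?_
  simp only [mulVec, dotProduct]
  exact Finset.measurable_sum _ fun j _ => ((measurable_entry i j).comp measurable_fst).mul
    ((measurable_pi_apply (X := fun _ => ℝ) j).comp measurable_snd)

theorem measurableSet_sqError_model_le {d : ℕ} {f : (Fin 2 → ℝ) → Bool} (hf : Measurable f)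
    {g : (Fin d → ℝ) → Bool} (hg : Measurable g) (r : ℝ) :
    MeasurableSet {V : Frame d | sqError g (model f V) ≤ r} := by
  have measurable_integrand : Measurable fun p : Frame d × (Fin d → ℝ) =>
      (label (g p.2) - label (model f p.1 p.2)) ^ 2 :=
    ((measurable_label.comp (hg.comp measurable_snd)).sub
      (measurable_label.comp (hf.comp (measurable_frame_mulVec d)))).pow_const 2
  exact measurableSet_le measurable_integrand.stronglyMeasurable.integral_prod_right'.measurable
    measurable_const

theorem integrable_sq_label_sub_label {d : ℕ} {f g : (Fin d → ℝ) → Bool} (hf : Measurable f)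
    (hg : Measurable g) : Integrable (fun x => (label (f x) - label (g x)) ^ 2) (gauss d) :=
  .of_bound (((measurable_label.comp hf).sub (measurable_label.comp hg)).pow_const
    2).aestronglyMeasurable 1 <| .of_forall fun x => by
      rw [Real.norm_eq_abs, abs_pow]
      exact pow_le_one₀ (abs_nonneg _) (abs_label_sub_label_le_one _ _)

theorem sqError_triangle {d : ℕ} {f g h : (Fin d → ℝ) → Bool} (hf : Measurable f)
    (hg : Measurable g) (hh : Measurable h) : sqError f h ≤ sqError f g + sqError h g := by
  unfold sqError
  rw [← integral_add (integrable_sq_label_sub_label hf hg) (integrable_sq_label_sub_label hh hg)]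
  refine integral_mono (integrable_sq_label_sub_label hf hh)
    ((integrable_sq_label_sub_label hf hg).add (integrable_sq_label_sub_label hh hg)) fun x => ?_
  change _ ≤ (label (f x) - label (g x)) ^ 2 + (label (h x) - label (g x)) ^ 2
  cases f x <;> cases g x <;> cases h x <;> simp [label]

/-- The vector of the scaled cube `{±1/√n}^n` whose positive coordinates are those in `S`. -/
noncomputable def signVector {n : ℕ} (S : Finset (Fin n)) (j : Fin n) : ℝ :=
  (if j ∈ S then 1 else -1) / √n

theorem signVector_dotProduct_self {n : ℕ} [NeZero n] (S : Finset (Fin n)) :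
    signVector S ⬝ᵥ signVector S = 1 := by
  have mul_self (j) : signVector S j * signVector S j = 1 / n := by
    rw [signVector, ← sq, div_pow, Real.sq_sqrt (Nat.cast_nonneg n)]
    split_ifs <;> norm_num
  simp only [dotProduct, mul_self, Finset.sum_const, Finset.card_univ, Fintype.card_fin,
    nsmul_eq_mul]
  exact mul_one_div_cancel (NeZero.ne _)

theorem signVector_sub_dotProduct_self {n : ℕ} (S S' : Finset (Fin n)) :
    (signVector S - signVector S') ⬝ᵥ (signVector S - signVector S') =
      4 * (symmDiff S S').card / n := by
  have mul_self (j) : (signVector S - signVector S') j * (signVector S - signVector S') j =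
      if j ∈ symmDiff S S' then (4 : ℝ) / n else 0 := by
    simp only [Pi.sub_apply, signVector, ← sub_div, ← sq, div_pow,
      Real.sq_sqrt (Nat.cast_nonneg n), Finset.mem_symmDiff]
    by_cases hS : j ∈ S <;> by_cases hS' : j ∈ S' <;> norm_num [hS, hS']
  simp only [dotProduct, mul_self, Finset.sum_ite_mem, Finset.univ_inter, Finset.sum_const,
    nsmul_eq_mul]
  ring

/-- The frame with second row `signVector S`; these `2 ^ n` frames are the hard instances. -/
noncomputable def signFrame {n : ℕ} [NeZero n] (S : Finset (Fin n)) : Frame (n + 1) :=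
  axisFrame (signVector S) (signVector_dotProduct_self S)

theorem SignProfile.four_mul_card_symmDiff_le {m n : ℕ} [NeZero n] (P : SignProfile m) {C : ℝ}
    (hC : 2 ≤ P.secondCorr ^ 2 * C) {S S' : Finset (Fin n)} {g : (Fin (n + 1) → ℝ) → Bool}
    (hg : Measurable g) (hS : sqError (model P.link (signFrame S)) g ≤ 1 / C)
    (hS' : sqError (model P.link (signFrame S')) g ≤ 1 / C) :
    4 * (symmDiff S S').card ≤ n := by
  have n_pos : (0 : ℝ) < n := Nat.cast_pos.2 (NeZero.pos n)
  have C_pos : 0 < C := pos_of_mul_pos_right (two_pos.trans_le hC) (sq_nonneg _)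
  have sq_norm_sub : ((signFrame S).1 1 - (signFrame S').1 1) ⬝ᵥ
      ((signFrame S).1 1 - (signFrame S').1 1) = 4 * (symmDiff S S').card / n := by
    rw [← signVector_sub_dotProduct_self]
    simp [signFrame, axisFrame, dotProduct, Fin.sum_univ_succ]
  have separation := P.secondCorr_sq_mul_le_sqError (U := signFrame S) (V := signFrame S') rfl
  have triangle := sqError_triangle (P.measurable_model (signFrame S)) hg
    (P.measurable_model (signFrame S'))
  rw [sq_norm_sub] at separation
  have scaled : P.secondCorr ^ 2 * (4 * (symmDiff S S').card / n) ≤ P.secondCorr ^ 2 * 1 :=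
    calc _ ≤ 1 / C + 1 / C := by linarith
      _ = 2 / C := by ring
      _ ≤ P.secondCorr ^ 2 * 1 := by rwa [mul_one, div_le_iff₀ C_pos]
  have ratio_le := le_of_mul_le_mul_left scaled (pow_pos P.secondCorr_pos 2)
  rw [div_le_one n_pos] at ratio_le
  exact_mod_cast ratio_le

/- Chernoff's argument: `∑ S, t ^ (4 * #S) = (1 + t ^ 4) ^ n`, for `t = 4 / 5`. -/
theorem ncard_four_mul_card_le (ι : Type*) [Fintype ι] :
    ({S : Finset ι | 4 * S.card ≤ Fintype.card ι}.ncard : ℝ) ≤ (9 / 5) ^ Fintype.card ι := by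
  classical
  rw [Set.ncard_eq_toFinset_card']
  set B := {S : Finset ι | 4 * S.card ≤ Fintype.card ι}.toFinset
  set n := Fintype.card ι
  have weighted : (B.card : ℝ) * (4 / 5) ^ n ≤ (9 / 5) ^ n * (4 / 5) ^ n :=
    calc (B.card : ℝ) * (4 / 5) ^ n = ∑ _S ∈ B, (4 / 5 : ℝ) ^ n := by
          rw [Finset.sum_const, nsmul_eq_mul]
      _ ≤ ∑ S ∈ B, ((4 / 5 : ℝ) ^ 4) ^ S.card := Finset.sum_le_sum fun _ hS => by
          rw [← pow_mul]
          exact pow_le_pow_of_le_one (by norm_num) (by norm_num) (by simpa [B] using hS)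
      _ ≤ ∑ S : Finset ι, ((4 / 5 : ℝ) ^ 4) ^ S.card :=
          Finset.sum_le_sum_of_subset_of_nonneg (Finset.subset_univ _) fun _ _ _ => by positivity
      _ = ((4 / 5) ^ 4 + 1) ^ n := by
          simpa using Fintype.sum_pow_mul_eq_add_pow ι ((4 / 5 : ℝ) ^ 4) 1
      _ ≤ (9 / 5) ^ n * (4 / 5) ^ n := by
          rw [← mul_pow]
          gcongr
          norm_num
  exact le_of_mul_le_mul_right weighted (by positivity)

theorem SignProfile.ncard_sqError_signFrame_le {m n : ℕ} [NeZero n] (P : SignProfile m) {C : ℝ}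
    (hC : 2 ≤ P.secondCorr ^ 2 * C) {g : (Fin (n + 1) → ℝ) → Bool} (hg : Measurable g) :
    ({S : Finset (Fin n) | sqError (model P.link (signFrame S)) g ≤ 1 / C}.ncard : ℝ) ≤
      (9 / 5) ^ n := by
  rcases Set.eq_empty_or_nonempty {S : Finset (Fin n) |
    sqError (model P.link (signFrame S)) g ≤ 1 / C} with empty | ⟨S₀, hS₀⟩
  · rw [empty, Set.ncard_empty, Nat.cast_zero]
    positivity
  · have ball := ncard_four_mul_card_le (Fin n)
    rw [Fintype.card_fin] at ball
    refine le_trans (Nat.cast_le.2 (Set.ncard_le_ncard_of_injOn (symmDiff S₀) (fun S hS => ?_)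
      (symmDiff_right_injective S₀).injOn)) ball
    exact P.four_mul_card_symmDiff_le hC hg hS₀ hS

theorem exists_measure_le_of_ncard_le {ι Ω : Type*} [Fintype ι] [Nonempty ι] [MeasurableSpace Ω]
    (μ : Measure Ω) [IsProbabilityMeasure μ] {B : ι → Set Ω} (hB : ∀ i, MeasurableSet (B i))
    {t : ENNReal} (hcard : ∀ ω, ({i | ω ∈ B i}.ncard : ENNReal) ≤ Fintype.card ι * t) :
    ∃ i, μ (B i) ≤ t := by
  classical
  have sum_indicator (ω) : ∑ i, (B i).indicator (1 : Ω → ENNReal) ω = {i | ω ∈ B i}.ncard := by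
    simp [Set.indicator_apply, Finset.sum_boole, Set.ncard_eq_toFinset_card']
  have sum_measure_le : ∑ i, μ (B i) ≤ ∑ _i : ι, t :=
    calc ∑ i, μ (B i) = ∫⁻ ω, ∑ i, (B i).indicator 1 ω ∂μ := by
          rw [lintegral_finsetSum _ fun i _ => measurable_one.indicator (hB i)]
          simp only [lintegral_indicator_one (hB _)]
      _ ≤ ∫⁻ _, Fintype.card ι * t ∂μ :=
          lintegral_mono fun ω => (sum_indicator ω).trans_le (hcard ω)
      _ = ∑ _i : ι, t := by simp
  by_contra! lt_measure
  exact sum_measure_le.not_gt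
    (ENNReal.sum_lt_sum_of_nonempty Finset.univ_nonempty fun i _ => lt_measure i)

theorem SignProfile.exists_frame_measure_le {m k d : ℕ} (P : SignProfile m) (hk : k ≤ m)
    (hd : 2 ≤ d) {C : ℝ} (hC : 2 ≤ P.secondCorr ^ 2 * C)
    (A : MomentTable d k → ProbabilityMeasure (Frame d)) :
    ∃ U : Frame d, (A (moments k (model P.link U)) : Measure (Frame d))
        {V | sqError (model P.link U) (model P.link V) ≤ 1 / C} ≤
      ENNReal.ofReal (Real.exp (-(1 / 20 * d))) := by
  obtain ⟨n, rfl⟩ : ∃ n, d = n + 1 := ⟨d - 1, by omega⟩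
  have : NeZero n := ⟨by omega⟩
  have moments_eq (S : Finset (Fin n)) :
      moments k (model P.link (signFrame S)) = moments k (model P.link (signFrame ∅)) :=
    moments_model_axisFrame P hk _ _
  obtain ⟨S, hS⟩ := exists_measure_le_of_ncard_le (t := ENNReal.ofReal ((9 / 10) ^ n))
    (A (moments k (model P.link (signFrame ∅))) : Measure (Frame (n + 1)))
    (fun S : Finset (Fin n) => measurableSet_sqError_model_le P.measurable_link
      (P.measurable_model (signFrame S)) (1 / C)) fun V => by
        rw [← ENNReal.ofReal_natCast, ← ENNReal.ofReal_natCast (Fintype.card _),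
          ← ENNReal.ofReal_mul (Nat.cast_nonneg _), Fintype.card_finset, Fintype.card_fin,
          Nat.cast_pow, ← mul_pow]
        refine ENNReal.ofReal_le_ofReal
          ((P.ncard_sqError_signFrame_le hC (P.measurable_model V)).trans_eq ?_)
        norm_num
  refine ⟨signFrame S, ?_⟩
  rw [moments_eq]
  refine hS.trans (ENNReal.ofReal_le_ofReal ?_)
  have one_le : (1 : ℝ) ≤ n := Nat.one_le_cast.2 NeZero.one_le
  calc (9 / 10 : ℝ) ^ n ≤ Real.exp (-(1 / 10)) ^ n := by
        gcongr
        linarith [Real.add_one_le_exp (-(1 / 10) : ℝ)]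
    _ = Real.exp (-(n / 10)) := by rw [← Real.exp_nat_mul]; ring_nf
    _ ≤ Real.exp (-(1 / 20 * (n + 1 : ℕ))) := Real.exp_le_exp.2 (by push_cast; linarith)

end LowerBound

end MIM

theorem theoremF1 :
    ∃ K : ℕ, ∀ C₁ : ℕ, ∃ f : (Fin 2 → ℝ) → Bool, Measurable f ∧
      ∃ C₀ : ℝ, 0 < C₀ ∧ ∃ c : ℝ, 0 < c ∧ ∃ d₀ : ℕ,
        ∀ C₂ : ℝ, C₀ ≤ C₂ → ∀ d : ℕ, d₀ ≤ d →
          -- no (randomized) algorithm can learn from the exact moments of degree at most `C₁`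
          (∀ A : MIM.MomentTable d C₁ → ProbabilityMeasure (MIM.Frame d),
            ∃ U : MIM.Frame d,
              (A (MIM.moments C₁ (MIM.model f U)) : Measure (MIM.Frame d))
                  {V | MIM.sqError (MIM.model f U) (MIM.model f V) ≤ 1 / C₂}
                ≤ ENNReal.ofReal (Real.exp (-(c * d)))) ∧
          -- a statistical query algorithm with `O(d²)` queries recovers the hidden matrix
          (∃ n : ℕ, n ≤ K * d ^ 2 ∧
            ∃ A : ℝ → MIM.SQAlgorithm ((Fin d → ℝ) × Bool) (Matrix (Fin 2) (Fin d) ℝ) n,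
              ∀ ε : ℝ, 0 < ε → ∀ U : MIM.Frame d, ∀ a : Fin n → ℝ,
                (A ε).IsTranscript (MIM.labelledLaw (MIM.model f U)) (C₂ * d ^ 2 / ε ^ 2) a →
                  ‖(A ε).output a - U.1‖ ≤ ε) := by
  refine ⟨2, fun C₁ => ?_⟩
  obtain ⟨P⟩ := MIM.nonempty_signProfile (C₁ + 1)
  have one_le : 1 ≤ C₁ + 1 := Nat.le_add_left 1 C₁
  have secondCorr_pos := P.secondCorr_pos
  have amplification_pos := P.amplification_pos one_le
  refine ⟨P.link, P.measurable_link, 2 / P.secondCorr ^ 2 + 2 * P.amplification ^ 2,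
    by positivity, 1 / 20, by norm_num, 2, fun C₂ hC₂ d hd => ⟨?_, 2 * d, by nlinarith,
      fun ε => P.sqAlgorithm d (√C₂ * d / ε), fun ε hε U a ha => ?_⟩⟩
  · refine P.exists_frame_measure_le (Nat.le_succ C₁) hd ?_
    rw [← div_le_iff₀' (by positivity)]
    exact le_of_add_le_of_nonneg_left hC₂ (by positivity)
  · exact P.norm_output_sub_le one_le (one_le_two.trans hd)
      (le_of_add_le_of_nonneg_right hC₂ (by positivity)) hε ha
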